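/- Let $\mathbb{K}$ be a field of characteristic $0$ and let $G=(V,E)$ be a finite simple graph (possibly empty). Write $\mathrm{cc}(J)$ for the number of connected components of a graph $J$, $r(J)=|V(J)|-\mathrm{cc}(J)$ for its rank and $n(J)=|E(J)|-r(J)$ for its nullity; for $F\subseteq E$ let $G_{|F}=(V,F)$. The Fortuin–Kasteleyn polynomial and the Tutte polynomial of $G$ are the elements of $\mathbb{K}[X,Y]$ $$Z_G(X,Y)=\sum_{F\subseteq E}X^{\mathrm{cc}(G_{|F})}Y^{|F|},\qquad T_G(X,Y)=\sum_{F\subseteq E}(X-1)^{r(G)-r(G_{|F})}(Y-1)^{n(G_{|F})}.$$ A mixed graph $H$ consists of a finite vertex set $V(H)$, a set $E(H)$ of edges (unordered pairs $\{x,y\}$ of distinct vertices) and a set $A(H)$ of arcs (ordered pairs $(x,y)$ of distinct vertices), such that for distinct vertices $x,y$ at most one of $\{x,y\}\in E(H)$, $(x,y)\in A(H)$, $(y,x)\in A(H)$ holds. Let $\mathrm{gr}(H)$ be the simple graph on $V(H)$ with edge set $E(H)\cup\{\{x,y\}:(x,y)\in A(H)\}$, and $\mathrm{gr}_0(H)$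 the simple graph on $V(H)$ with edge set $E(H)$. A partial orientation of $G$ is a mixed graph $H$ with $\mathrm{gr}(H)=G$. It is totally acyclic if there is no sequence $(x_0,\dots,x_n)$ of vertices with $n\ge 2$ and $x_0=x_n$ such that, for every $1\le i\le n$, $\{x_{i-1},x_i\}\in E(H)$ or $(x_{i-1},x_i)\in A(H)$, and $(x_{i-1},x_i)\in A(H)$ for at least one $i$. Let $\mathcal{PO}_{\mathrm{tac}}(G)$ be the set of totally acyclic partial orientations of $G$. Then the following two identities hold in $\mathbb{K}[X,Y]$: $$Z_G(-X,Y)=\sum_{H\in\mathcal{PO}_{\mathrm{tac}}(G)}(-1)^{\mathrm{cc}(\mathrm{gr}_0(H))}\,Z_{\mathrm{gr}_0(H)}(X,Y),$$ $$T_G(2-X,Y)=\sum_{H\in\mathcal{PO}_{\mathrm{tac}}(G)}(1-X)^{\mathrm{cc}(\mathrm{gr}_0(H))-\mathrm{cc}(G)}\,T_{\mathrm{gr}_0(H)}(X,Y).$$ -/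

import Mathlib

/-- The number `cc(G)` of connected components of a graph. -/
noncomputable def SimpleGraph.cc {V : Type*} (G : SimpleGraph V) : ℕ :=
  Nat.card G.ConnectedComponent

/-- The rank `r(G) = |V(G)| - cc(G)`. The subtraction is exact, see
`SimpleGraph.graphRank_add_cc`. -/
noncomputable def SimpleGraph.graphRank {V : Type*} [Fintype V] (G : SimpleGraph V) : ℕ :=
  Fintype.card V - G.cc

/-- The nullity `n(G) = |E(G)| - r(G)`. The subtraction is exact, see
`SimpleGraph.nullity_add_graphRank`. -/
noncomputable def SimpleGraph.nullity {V : Type*} [Fintype V] (G : SimpleGraph V) : ℕ :=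
  Nat.card G.edgeSet - G.graphRank

theorem SimpleGraph.cc_le_card {V : Type*} [Fintype V] (G : SimpleGraph V) :
    G.cc ≤ Fintype.card V := by
  rw [SimpleGraph.cc, ← Nat.card_eq_fintype_card]
  exact Nat.card_le_card_of_surjective G.connectedComponentMk Quot.mk_surjective

theorem SimpleGraph.graphRank_add_cc {V : Type*} [Fintype V] (G : SimpleGraph V) :
    G.graphRank + G.cc = Fintype.card V :=
  Nat.sub_add_cancel G.cc_le_card

theorem SimpleGraph.cc_anti {V : Type*} [Fintype V] {G G' : SimpleGraph V} (h : G ≤ G') :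
    G'.cc ≤ G.cc :=
  SimpleGraph.ConnectedComponent.card_le_card_of_le h

theorem SimpleGraph.graphRank_mono {V : Type*} [Fintype V] {G G' : SimpleGraph V}
    (h : G ≤ G') : G.graphRank ≤ G'.graphRank :=
  Nat.sub_le_sub_left (SimpleGraph.cc_anti h) _

theorem SimpleGraph.card_le_cc_add_card_edgeSet {V : Type*} [Fintype V] (G : SimpleGraph V) :
    Fintype.card V ≤ G.cc + Nat.card G.edgeSet := by
  classical
  have hreach : ∀ v, G.Reachable v (G.connectedComponentMk v).out := fun v =>
    SimpleGraph.ConnectedComponent.exact (Quot.out_eq (G.connectedComponentMk v)).symm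
  have hstep : ∀ v, v ≠ (G.connectedComponentMk v).out → ∃ u, G.Adj v u ∧
      G.dist u (G.connectedComponentMk v).out < G.dist v (G.connectedComponentMk v).out := by
    intro v hv
    obtain ⟨p, hp⟩ := (hreach v).exists_walk_length_eq_dist
    revert hv hp
    generalize (G.connectedComponentMk v).out = r at p
    intro hv hp
    cases p with
    | nil => exact absurd rfl hv
    | cons h q =>
      refine ⟨_, h, ?_⟩
      rw [← hp, SimpleGraph.Walk.length_cons]
      exact Nat.lt_succ_of_le (SimpleGraph.dist_le q)
  choose p hadj hlt using hstep
  let f : V → G.ConnectedComponent ⊕ G.edgeSet := fun v =>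
    if hv : v = (G.connectedComponentMk v).out then Sum.inl (G.connectedComponentMk v)
    else Sum.inr ⟨s(v, p v hv), hadj v hv⟩
  have hf : Function.Injective f := by
    intro v w hvw
    by_cases hv : v = (G.connectedComponentMk v).out
    · by_cases hw : w = (G.connectedComponentMk w).out
      · simp only [f, dif_pos hv, dif_pos hw, Sum.inl.injEq] at hvw
        rw [hv, hw, hvw]
      · simp [f, dif_pos hv, dif_neg hw] at hvw
    · by_cases hw : w = (G.connectedComponentMk w).out
      · simp [f, dif_neg hv, dif_pos hw] at hvw
      · simp only [f, dif_neg hv, dif_neg hw, Sum.inr.injEq] at hvw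
        rcases Sym2.eq_iff.1 (congrArg Subtype.val hvw) with ⟨h, _⟩ | ⟨h1, h2⟩
        · exact h
        · exfalso
          have hc : G.connectedComponentMk v = G.connectedComponentMk w := by
            apply SimpleGraph.ConnectedComponent.sound
            have := (hadj v hv).reachable
            rwa [h2] at this
          have a := hlt v hv
          have b := hlt w hw
          rw [h2] at a
          rw [← h1, ← hc] at b
          exact absurd (a.trans b) (lt_irrefl _)
  have := Nat.card_le_card_of_injective f hf
  rwa [Nat.card_sum, Nat.card_eq_fintype_card] at this

theorem SimpleGraph.nullity_add_graphRank {V : Type*} [Fintype V] (G : SimpleGraph V) :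
    G.nullity + G.graphRank = Nat.card G.edgeSet := by
  refine Nat.sub_add_cancel ?_
  have := G.card_le_cc_add_card_edgeSet
  have := G.graphRank_add_cc
  omega

open Classical in
/-- The Fortuin-Kasteleyn polynomial `Z_G(X, Y) = ∑_{F ⊆ E(G)} X ^ cc(G|F) * Y ^ |F|`, where `G|F`
is the graph with the vertices of `G` and edge set `F`. The variables are `X 0` and `X 1`. -/
noncomputable def SimpleGraph.fortuinKasteleyn (K : Type*) [CommRing K] {V : Type*} [Fintype V]
    (G : SimpleGraph V) : MvPolynomial (Fin 2) K :=
  ∑ F ∈ G.edgeFinset.powerset,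
    MvPolynomial.X 0 ^ (SimpleGraph.fromEdgeSet (F : Set (Sym2 V))).cc * MvPolynomial.X 1 ^ F.card

open Classical in
/-- The rank-generating polynomial
`S_G(X, Y) = ∑_{F ⊆ E(G)} X ^ (r(G) - r(G|F)) * Y ^ n(G|F)`. -/
noncomputable def SimpleGraph.rankGenerating (K : Type*) [CommRing K] {V : Type*} [Fintype V]
    (G : SimpleGraph V) : MvPolynomial (Fin 2) K :=
  ∑ F ∈ G.edgeFinset.powerset,
    MvPolynomial.X 0 ^ (G.graphRank - (SimpleGraph.fromEdgeSet (F : Set (Sym2 V))).graphRank) *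
      MvPolynomial.X 1 ^ (SimpleGraph.fromEdgeSet (F : Set (Sym2 V))).nullity

/-- The polynomial `P(a, b)` obtained by substituting polynomials `a`, `b` for the two
variables. -/
noncomputable def subst2 {K : Type*} [CommRing K] (a b : MvPolynomial (Fin 2) K)
    (P : MvPolynomial (Fin 2) K) : MvPolynomial (Fin 2) K :=
  MvPolynomial.aeval ![a, b] P

/-- The Tutte polynomial `T_G(X, Y) = S_G(X - 1, Y - 1)`. -/
noncomputable def SimpleGraph.tuttePolynomial (K : Type*) [CommRing K] {V : Type*} [Fintype V]
    (G : SimpleGraph V) : MvPolynomial (Fin 2) K :=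
  subst2 (MvPolynomial.X 0 - 1) (MvPolynomial.X 1 - 1) (G.rankGenerating K)

/-- A mixed graph on the vertex set `V`: a set of (unoriented) edges and a set of arcs, with at
most one edge or arc between any two distinct vertices and no loops. -/
@[ext]
structure MixedGraph (V : Type*) where
  /-- `edge x y` means `{x, y} ∈ E(H)` -/
  edge : V → V → Prop
  /-- `arc x y` means `(x, y) ∈ A(H)` -/
  arc : V → V → Prop
  edge_symm : ∀ x y, edge x y → edge y x
  edge_irrefl : ∀ x, ¬ edge x x
  arc_irrefl : ∀ x, ¬ arc x x
  not_arc_of_edge : ∀ x y, edge x y → ¬ arc x y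
  not_arc_swap_of_arc : ∀ x y, arc x y → ¬ arc y x

namespace MixedGraph

/-- The simple graph `gr(H)`, obtained by forgetting the orientations of the arcs. -/
def gr {V : Type*} (H : MixedGraph V) : SimpleGraph V where
  Adj x y := H.edge x y ∨ H.arc x y ∨ H.arc y x
  symm := ⟨fun x y h => h.elim (fun h => Or.inl (H.edge_symm x y h)) fun h => Or.inr h.symm⟩
  loopless := ⟨fun x h => h.elim (H.edge_irrefl x) fun h =>
    h.elim (H.arc_irrefl x) (H.arc_irrefl x)⟩

/-- The simple graph `gr₀(H)`, obtained by removing the arcs. -/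
def gr₀ {V : Type*} (H : MixedGraph V) : SimpleGraph V where
  Adj x y := H.edge x y
  symm := ⟨H.edge_symm⟩
  loopless := ⟨H.edge_irrefl⟩

theorem gr₀_le_gr {V : Type*} (H : MixedGraph V) : H.gr₀ ≤ H.gr := fun _ _ h => Or.inl h

/-- `H` is totally acyclic if there is no closed sequence `(x_0, …, x_n = x_0)`, `n ≥ 2`, of
vertices following edges (in either direction) and arcs (in their direction), with at least one
arc. -/
def TotallyAcyclic {V : Type*} (H : MixedGraph V) : Prop :=
  ¬ ∃ (n : ℕ) (x : Fin (n + 1) → V), 2 ≤ n ∧ x 0 = x (Fin.last n) ∧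
    (∀ i : Fin n, H.edge (x i.castSucc) (x i.succ) ∨ H.arc (x i.castSucc) (x i.succ)) ∧
    ∃ i : Fin n, H.arc (x i.castSucc) (x i.succ)

instance finite {V : Type*} [Finite V] : Finite (MixedGraph V) :=
  Finite.of_injective (fun H : MixedGraph V => (H.edge, H.arc)) fun _ _ h =>
    MixedGraph.ext (congrArg Prod.fst h) (congrArg Prod.snd h)

end MixedGraph

/-- The finite set of totally acyclic partial orientations of `G`, that is, of the totally acyclic
mixed graphs `H` with `gr(H) = G`. -/
noncomputable def SimpleGraph.totallyAcyclicPartialOrientations {V : Type*} [Fintype V]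
    (G : SimpleGraph V) : Finset (MixedGraph V) :=
  (Set.toFinite {H : MixedGraph V | H.gr = G ∧ H.TotallyAcyclic}).toFinset

theorem SimpleGraph.mem_totallyAcyclicPartialOrientations {V : Type*} [Fintype V]
    (G : SimpleGraph V) (H : MixedGraph V) :
    H ∈ G.totallyAcyclicPartialOrientations ↔ H.gr = G ∧ H.TotallyAcyclic := by
  simp [SimpleGraph.totallyAcyclicPartialOrientations]

theorem SimpleGraph.cc_le_cc_gr₀ {V : Type*} [Fintype V] (G : SimpleGraph V) (H : MixedGraph V)
    (hH : H ∈ G.totallyAcyclicPartialOrientations) : G.cc ≤ H.gr₀.cc := by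
  rw [← ((G.mem_totallyAcyclicPartialOrientations H).1 hH).1]
  exact SimpleGraph.cc_anti H.gr₀_le_gr

/-! Exchange the sums on the right so that an edge set `F` of `G` is chosen before the orientation
`H`. Both identities then reduce to one signed count, `sum_sign_totallyAcyclicPartialOrientations`:
the sum of `(-1) ^ cc(gr₀ H)` over the `H` with `F ≤ gr₀ H` is `(-1) ^ cc(F)`. For the Tutte
polynomial, `1 - X = -(X - 1)` makes the exponents of `X - 1` telescope, so that `H` again
contributes only this sign.

The count is an induction on `G`, removing an edge `xy` outside `F`. A totally acyclic `H` on the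
smaller graph has three candidate extensions: an edge or one of two arcs. Which of them are totally
acyclic depends only on whether `H` leads from `x` to `y` and from `y` to `x`, and in every case the
signs of the admissible ones add up to the sign of `H` (`sum_setPair_sign`). -/

open Relation in
/-- Reachability after adding one step `x → y` to a relation. -/
theorem Relation.reflTransGen_addStep {α : Type*} {r r' : α → α → Prop} {x y : α}
    (h : ∀ a b, r' a b ↔ r a b ∨ (a = x ∧ b = y)) (a b : α) :
    ReflTransGen r' a b ↔ ReflTransGen r a b ∨ (ReflTransGen r a x ∧ ReflTransGen r y b) := by
  have hle : ∀ {a b}, ReflTransGen r a b → ReflTransGen r' a b :=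
    fun hab => ReflTransGen.mono (fun a b hab => (h a b).2 (Or.inl hab)) _ _ hab
  constructor
  · intro hab
    induction hab with
    | refl => exact Or.inl .refl
    | tail _ hbc ih =>
      rcases (h _ _).1 hbc with hbc | ⟨rfl, rfl⟩
      · exact ih.imp (fun h => h.tail hbc) fun h => ⟨h.1, h.2.tail hbc⟩
      · exact Or.inr ⟨ih.elim id And.left, .refl⟩
  · rintro (hab | ⟨hax, hyb⟩)
    · exact hle hab
    · exact ((hle hax).tail ((h _ _).2 (Or.inr ⟨rfl, rfl⟩))).trans (hle hyb)

open Relation in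
/-- Reachability after adding the two steps `x → y` and `y → x` to a relation. -/
theorem Relation.reflTransGen_addSteps {α : Type*} {r r' : α → α → Prop} {x y : α}
    (h : ∀ a b, r' a b ↔ r a b ∨ (a = x ∧ b = y) ∨ (a = y ∧ b = x)) (a b : α) :
    ReflTransGen r' a b ↔ ReflTransGen r a b ∨ (ReflTransGen r a x ∧ ReflTransGen r y b) ∨
      (ReflTransGen r a y ∧ ReflTransGen r x b) := by
  have h1 := reflTransGen_addStep (r := r) (r' := fun a b => r a b ∨ (a = x ∧ b = y))
    (x := x) (y := y) fun _ _ => Iff.rfl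
  rw [reflTransGen_addStep (r := fun a b => r a b ∨ (a = x ∧ b = y)) (x := y) (y := x)
    (by intro a b; rw [h]; tauto), h1, h1, h1]
  constructor
  · rintro (h | ⟨h1 | h1, h2 | h2⟩)
    · tauto
    · tauto
    -- A path using both new steps comes back to `y` (here) or to `x` (next case), and the loop can
    -- be cut out.
    · exact Or.inl (h1.trans h2.2)
    · exact Or.inl (h1.1.trans h2)
    · exact Or.inr (Or.inl ⟨h1.1, h2.2⟩)
  · rintro (h | h | ⟨h1, h2⟩)
    · exact Or.inl (Or.inl h)
    · exact Or.inl (Or.inr h)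
    · exact Or.inr ⟨Or.inl h1, Or.inl h2⟩

/-! ### Connected components after adding an edge -/

namespace SimpleGraph

variable {V : Type*}

theorem cc_eq_of_reachable_iff {G G' : SimpleGraph V} (hle : G ≤ G')
    (h : ∀ a b, G'.Reachable a b → G.Reachable a b) : G'.cc = G.cc := by
  refine (Nat.card_eq_of_bijective (ConnectedComponent.map (Hom.ofLE hle)) ⟨?_,
    ConnectedComponent.surjective_map_ofLE hle⟩).symm
  intro c d
  induction c using ConnectedComponent.ind
  induction d using ConnectedComponent.ind
  intro hcd
  exact ConnectedComponent.sound (h _ _ (ConnectedComponent.exact hcd))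

theorem reachable_sup_edge_iff {G : SimpleGraph V} {x y : V} (hxy : x ≠ y) (a b : V) :
    (G ⊔ edge x y).Reachable a b ↔ G.Reachable a b ∨ (G.Reachable a x ∧ G.Reachable y b) ∨
      (G.Reachable a y ∧ G.Reachable x b) := by
  simp only [reachable_iff_reflTransGen]
  refine Relation.reflTransGen_addSteps (fun a b => ?_) a b
  simp only [sup_adj, edge_adj]
  grind

theorem cc_sup_edge_of_reachable {G : SimpleGraph V} {x y : V} (hxy : x ≠ y)
    (h : G.Reachable x y) : (G ⊔ edge x y).cc = G.cc := by
  refine cc_eq_of_reachable_iff le_sup_left fun a b hab => ?_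
  rcases (reachable_sup_edge_iff hxy a b).1 hab with h' | ⟨h1, h2⟩ | ⟨h1, h2⟩
  · exact h'
  · exact (h1.trans h).trans h2
  · exact (h1.trans h.symm).trans h2

theorem cc_sup_edge_of_not_reachable [Finite V] {G : SimpleGraph V} {x y : V} (hxy : x ≠ y)
    (h : ¬ G.Reachable x y) : G.cc = (G ⊔ edge x y).cc + 1 := by
  classical
  have := Fintype.ofFinite G.ConnectedComponent
  -- Only the components of `x` and `y` merge, so discarding that of `y` makes the quotient map
  -- bijective.
  let f : {c : G.ConnectedComponent // c ≠ G.connectedComponentMk y} →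
      (G ⊔ edge x y).ConnectedComponent := fun c =>
    ConnectedComponent.map (Hom.ofLE le_sup_left) c.1
  have hf : Function.Bijective f := by
    constructor
    · rintro ⟨c, hc⟩ ⟨d, hd⟩ hcd
      induction c using ConnectedComponent.ind
      induction d using ConnectedComponent.ind
      simp only [ne_eq, ConnectedComponent.eq] at hc hd
      have := (reachable_sup_edge_iff hxy _ _).1 (ConnectedComponent.exact hcd)
      refine Subtype.ext (ConnectedComponent.sound ?_)
      rcases this with h' | h' | h'
      · exact h'
      · exact absurd h'.2.symm hd
      · exact absurd h'.1 hc
    · intro c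
      induction c using ConnectedComponent.ind with | _ v
      by_cases hv : G.Reachable v y
      · refine ⟨⟨G.connectedComponentMk x, fun hx => h (ConnectedComponent.exact hx)⟩, ?_⟩
        refine ConnectedComponent.sound ((reachable_sup_edge_iff hxy _ _).2 ?_)
        exact Or.inr (Or.inl ⟨.refl _, hv.symm⟩)
      · exact ⟨⟨G.connectedComponentMk v, fun hx => hv (ConnectedComponent.exact hx)⟩, rfl⟩
  have hpos : 0 < Fintype.card G.ConnectedComponent :=
    Fintype.card_pos_iff.2 ⟨G.connectedComponentMk x⟩
  rw [cc, cc, ← Nat.card_eq_of_bijective f hf, Nat.card_eq_fintype_card,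
    Nat.card_eq_fintype_card, Fintype.card_subtype_compl, Fintype.card_subtype_eq]
  omega

end SimpleGraph

/-! ### Directed reachability and total acyclicity -/

namespace MixedGraph

open Relation

variable {V : Type*}

/-- A step along an edge, in either direction, or along an arc, in its direction. -/
def Step (H : MixedGraph V) (a b : V) : Prop := H.edge a b ∨ H.arc a b

/-- `b` can be reached from `a` along edges and arcs. -/
def Reach (H : MixedGraph V) : V → V → Prop := ReflTransGen H.Step

theorem reach_of_seq (H : MixedGraph V) : ∀ {n : ℕ} (x : Fin (n + 1) → V),
    (∀ i : Fin n, H.Step (x i.castSucc) (x i.succ)) → ∀ i j, i ≤ j → H.Reach (x i) (x j) := by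
  intro n x hx i j
  induction j using Fin.induction with
  | zero => intro h; rw [Fin.le_zero_iff.1 h]; exact .refl
  | succ j ih =>
    intro h
    rcases h.eq_or_lt with rfl | h
    · exact .refl
    · exact (ih (Fin.le_castSucc_iff.2 h)).tail (hx j)

theorem exists_seq_of_reach (H : MixedGraph V) {a b : V} (h : H.Reach a b) :
    ∃ (n : ℕ) (x : Fin (n + 1) → V), x 0 = a ∧ x (Fin.last n) = b ∧
      ∀ i : Fin n, H.Step (x i.castSucc) (x i.succ) := by
  induction h using ReflTransGen.head_induction_on with
  | refl => exact ⟨0, fun _ => b, rfl, rfl, fun i => i.elim0⟩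
  | @head a c hac _ ih =>
    obtain ⟨n, x, h0, hn, hx⟩ := ih
    refine ⟨n + 1, Fin.cons a x, rfl, ?_, ?_⟩
    · rw [← Fin.succ_last, Fin.cons_succ, hn]
    · intro i
      induction i using Fin.cases with
      | zero => simpa [h0] using hac
      | succ i => simpa [← Fin.succ_castSucc] using hx i

/-- A forbidden closed sequence can be rotated to start with one of its arcs; what remains is a
return path. -/
theorem totallyAcyclic_iff (H : MixedGraph V) :
    H.TotallyAcyclic ↔ ∀ a b, H.arc a b → ¬ H.Reach b a := by
  constructor
  · intro h a b hab hba
    obtain ⟨n, x, h0, hn, hx⟩ := H.exists_seq_of_reach hba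
    refine h ⟨n + 1, Fin.cons a x, ?_, ?_, ?_, 0, by simpa [h0] using hab⟩
    · rcases n with _ | n
      -- An empty return path would make the arc a loop; otherwise the closed sequence has length at
      -- least 2.
      · have : b = a := by rw [← h0, ← hn]; rfl
        exact absurd (this ▸ hab) (H.arc_irrefl _)
      · omega
    · rw [← Fin.succ_last, Fin.cons_succ, hn, Fin.cons_zero]
    · intro i
      induction i using Fin.cases with
      | zero => exact Or.inr (by simpa [h0] using hab)
      | succ i => simpa [← Fin.succ_castSucc, Step] using hx i
  · rintro h ⟨n, x, -, hx, hs, i, hi⟩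
    refine h _ _ hi ?_
    have h1 := H.reach_of_seq x hs _ _ (Fin.le_last i.succ)
    have h2 := H.reach_of_seq x hs _ _ (Fin.zero_le i.castSucc)
    rw [← hx] at h1
    exact h1.trans h2

/-- In a totally acyclic mixed graph, a closed walk follows edges only. -/
theorem TotallyAcyclic.reachable_of_reach {H H' : MixedGraph V} (hH : H.TotallyAcyclic)
    (he : ∀ a b, H'.edge a b → H.edge a b) (ha : ∀ a b, H'.arc a b → H.arc a b) {a b : V}
    (hab : H'.Reach a b) (hba : H.Reach b a) : H'.gr₀.Reachable a b := by
  rw [totallyAcyclic_iff] at hH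
  have hstep : ∀ a b, H'.Step a b → H.Step a b := fun a b => Or.imp (he a b) (ha a b)
  induction hab using ReflTransGen.head_induction_on with
  | refl => exact .refl _
  | @head a c hac hcb ih =>
    rcases hac with hac | hac
    · have : H'.gr₀.Adj a c := hac
      exact this.reachable.trans (ih (hba.tail (Or.inl (he _ _ hac))))
    · exact absurd ((ReflTransGen.mono hstep _ _ hcb).trans hba) (hH _ _ (ha _ _ hac))

theorem reach_of_reachable (H : MixedGraph V) {a b : V} (h : H.gr₀.Reachable a b) :
    H.Reach a b :=
  ReflTransGen.mono (fun _ _ => Or.inl) _ _ ((SimpleGraph.reachable_iff_reflTransGen _ _).1 h)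

/-- The components of `gr₀` are thus the strongly connected components, which ties `cc` to `Reach`.
-/
theorem TotallyAcyclic.reachable_iff {H : MixedGraph V} (hH : H.TotallyAcyclic) (a b : V) :
    H.gr₀.Reachable a b ↔ H.Reach a b ∧ H.Reach b a :=
  ⟨fun h => ⟨H.reach_of_reachable h, H.reach_of_reachable h.symm⟩,
    fun h => hH.reachable_of_reach (fun _ _ => id) (fun _ _ => id) h.1 h.2⟩

theorem TotallyAcyclic.mono {H H' : MixedGraph V} (hH : H.TotallyAcyclic)
    (he : ∀ a b, H'.edge a b → H.edge a b) (ha : ∀ a b, H'.arc a b → H.arc a b) :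
    H'.TotallyAcyclic := by
  rw [totallyAcyclic_iff] at *
  exact fun a b hab hba =>
    hH a b (ha _ _ hab) (ReflTransGen.mono (fun a b => Or.imp (he a b) (ha a b)) _ _ hba)

end MixedGraph

/-! ### Changing what joins one pair of vertices -/

namespace MixedGraph

open Relation

variable {V : Type*}

/-- Replace what joins `x` and `y`: nothing for `none`, an edge for `some none`, the arc `(x, y)`
for `some (some true)` and the arc `(y, x)` for `some (some false)`. -/
def setPair (H : MixedGraph V) {x y : V} (hxy : x ≠ y) (t : Option (Option Bool)) :
    MixedGraph V where
  edge a b := (s(a, b) = s(x, y) ∧ t = some none) ∨ (s(a, b) ≠ s(x, y) ∧ H.edge a b)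
  arc a b := (a = x ∧ b = y ∧ t = some (some true)) ∨ (a = y ∧ b = x ∧ t = some (some false)) ∨
    (s(a, b) ≠ s(x, y) ∧ H.arc a b)
  edge_symm a b := by
    rw [Sym2.eq_swap (a := a)]
    exact Or.imp_right (And.imp_right (H.edge_symm a b))
  edge_irrefl a := by
    have := H.edge_irrefl a
    grind
  arc_irrefl a := by
    have := H.arc_irrefl a
    grind
  not_arc_of_edge a b := by
    have := H.not_arc_of_edge a b
    grind
  not_arc_swap_of_arc a b := by
    have := H.not_arc_swap_of_arc a b
    grind

section

variable {H H' : MixedGraph V} {x y : V} (hxy : x ≠ y)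

theorem setPair_setPair (H : MixedGraph V) (t u : Option (Option Bool)) :
    (H.setPair hxy t).setPair hxy u = H.setPair hxy u := by
  ext a b <;> simp only [setPair] <;> grind

theorem setPair_none_of_not_adj (h : ¬ H.gr.Adj x y) : H.setPair hxy none = H := by
  have h1 : ¬ (H.edge x y ∨ H.arc x y ∨ H.arc y x) := h
  have h2 := H.edge_symm y x
  ext a b <;> simp only [setPair] <;> grind

theorem setPair_injective (H : MixedGraph V) : Function.Injective (H.setPair hxy) := by
  intro t u h
  have h1 : (H.setPair hxy t).edge x y ↔ (H.setPair hxy u).edge x y := by rw [h]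
  have h2 : (H.setPair hxy t).arc x y ↔ (H.setPair hxy u).arc x y := by rw [h]
  have h3 : (H.setPair hxy t).arc y x ↔ (H.setPair hxy u).arc y x := by rw [h]
  rcases t with _ | _ | _ | _ <;> rcases u with _ | _ | _ | _ <;>
    simp [setPair, hxy, hxy.symm] at h1 h2 h3 ⊢

theorem exists_setPair_some_eq (h : H.gr.Adj x y) :
    ∃ t : Option Bool, H.setPair hxy (some t) = H := by
  have h2 := H.edge_symm y x
  have h3 := H.edge_symm x y
  have h4 := H.not_arc_of_edge x y
  have h5 := H.not_arc_of_edge y x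
  have h6 := H.not_arc_swap_of_arc x y
  rcases h with h | h | h
  · refine ⟨none, ?_⟩
    ext a b <;> simp only [setPair] <;> grind
  · refine ⟨some true, ?_⟩
    ext a b <;> simp only [setPair] <;> grind
  · refine ⟨some false, ?_⟩
    ext a b <;> simp only [setPair] <;> grind

theorem gr_setPair_none (H : MixedGraph V) :
    (H.setPair hxy none).gr = H.gr \ SimpleGraph.edge x y := by
  ext a b
  simp only [setPair, gr, SimpleGraph.sdiff_adj, SimpleGraph.edge_adj]
  have := H.edge_irrefl a
  have := H.arc_irrefl a
  grind

theorem gr_setPair_some (H : MixedGraph V) (t : Option Bool) :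
    (H.setPair hxy (some t)).gr = H.gr ⊔ SimpleGraph.edge x y := by
  ext a b
  simp only [setPair, gr, SimpleGraph.sup_adj, SimpleGraph.edge_adj]
  rcases t with _ | _ | _ <;> grind

theorem step_setPair_forward (h : ¬ H.gr.Adj x y) (a b : V) :
    (H.setPair hxy (some (some true))).Step a b ↔ H.Step a b ∨ (a = x ∧ b = y) := by
  have h1 : ¬ (H.edge x y ∨ H.arc x y ∨ H.arc y x) := h
  have h2 := H.edge_symm y x
  simp only [setPair, Step]
  grind

theorem setPair_backward (H : MixedGraph V) :
    H.setPair hxy (some (some false)) = H.setPair hxy.symm (some (some true)) := by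
  ext a b <;> simp only [setPair] <;> grind

theorem step_setPair_edge (h : ¬ H.gr.Adj x y) (a b : V) :
    (H.setPair hxy (some none)).Step a b ↔
      H.Step a b ∨ (a = x ∧ b = y) ∨ (a = y ∧ b = x) := by
  have h1 : ¬ (H.edge x y ∨ H.arc x y ∨ H.arc y x) := h
  have h2 := H.edge_symm y x
  simp only [setPair, Step]
  grind

theorem gr₀_setPair_arc (h : ¬ H.gr.Adj x y) (t : Bool) :
    (H.setPair hxy (some (some t))).gr₀ = H.gr₀ := by
  have h1 : ¬ (H.edge x y ∨ H.arc x y ∨ H.arc y x) := h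
  have h2 := H.edge_symm y x
  ext a b
  simp only [setPair, gr₀]
  grind

theorem gr₀_setPair_edge (h : ¬ H.gr.Adj x y) :
    (H.setPair hxy (some none)).gr₀ = H.gr₀ ⊔ SimpleGraph.edge x y := by
  have h1 : ¬ (H.edge x y ∨ H.arc x y ∨ H.arc y x) := h
  have h2 := H.edge_symm y x
  ext a b
  simp only [setPair, gr₀, SimpleGraph.sup_adj, SimpleGraph.edge_adj]
  grind

theorem TotallyAcyclic.setPair_none (hH : H.TotallyAcyclic) :
    (H.setPair hxy none).TotallyAcyclic :=
  hH.mono (by simp [setPair]) (by simp [setPair])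

theorem totallyAcyclic_setPair_forward (hH : H.TotallyAcyclic) (h : ¬ H.gr.Adj x y) :
    (H.setPair hxy (some (some true))).TotallyAcyclic ↔ ¬ H.Reach y x := by
  have hr := reflTransGen_addStep (step_setPair_forward hxy h)
  rw [totallyAcyclic_iff] at hH ⊢
  constructor
  · intro hA hyx
    exact hA x y (Or.inl ⟨rfl, rfl, rfl⟩) ((hr _ _).2 (Or.inl hyx))
  · intro hyx a b hab hba
    have hba : H.Reach b a ∨ (H.Reach b x ∧ H.Reach y a) := (hr _ _).1 hba
    rcases hab with ⟨rfl, rfl, -⟩ | ⟨-, -, h⟩ | ⟨-, hab⟩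
    · tauto
    · simp at h
    · rcases hba with hba | ⟨hbx, hya⟩
      · exact hH a b hab hba
      -- A return path through the new arc would give `y → a → b → x` in `H`.
      · exact hyx ((hya.tail (Or.inr hab)).trans hbx)

theorem totallyAcyclic_setPair_backward (hH : H.TotallyAcyclic) (h : ¬ H.gr.Adj x y) :
    (H.setPair hxy (some (some false))).TotallyAcyclic ↔ ¬ H.Reach x y := by
  rw [setPair_backward, totallyAcyclic_setPair_forward _ hH fun h' => h h'.symm]

theorem totallyAcyclic_setPair_edge (hH : H.TotallyAcyclic) (h : ¬ H.gr.Adj x y) :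
    (H.setPair hxy (some none)).TotallyAcyclic ↔ (H.Reach x y ↔ H.Reach y x) := by
  have hs := step_setPair_edge hxy h
  have hr := reflTransGen_addSteps hs
  constructor
  · intro hE
    have hne : ∀ a b, H.gr.Adj a b → s(a, b) ≠ s(x, y) := fun a b hab heq =>
      h (by rwa [← SimpleGraph.mem_edgeSet, ← heq])
    have he : ∀ a b, H.edge a b → (H.setPair hxy (some none)).edge a b := fun a b hab =>
      Or.inr ⟨hne a b (Or.inl hab), hab⟩
    have ha : ∀ a b, H.arc a b → (H.setPair hxy (some none)).arc a b := fun a b hab =>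
      Or.inr (Or.inr ⟨hne a b (Or.inr (Or.inl hab)), hab⟩)
    have hxy' := (hs x y).2 (Or.inr (Or.inl ⟨rfl, rfl⟩))
    have hyx' := (hs y x).2 (Or.inr (Or.inr ⟨rfl, rfl⟩))
    -- The new edge closes a path of `H` between `x` and `y` into a cycle, so that path has no arc
    -- and can be reversed in `H`.
    exact ⟨fun h' => H.reach_of_reachable (hE.reachable_of_reach he ha h' (.single hyx')).symm,
      fun h' => H.reach_of_reachable (hE.reachable_of_reach he ha h' (.single hxy')).symm⟩
  · intro hiff
    rw [totallyAcyclic_iff] at hH ⊢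
    intro a b hab hba
    have hba : H.Reach b a ∨ (H.Reach b x ∧ H.Reach y a) ∨ (H.Reach b y ∧ H.Reach x a) :=
      (hr _ _).1 hba
    rcases hab with ⟨-, -, h⟩ | ⟨-, -, h⟩ | ⟨-, hab⟩
    · simp at h
    · simp at h
    · have hs : H.Reach a b := .single (Or.inr hab)
      rcases hba with hba | ⟨h1, h2⟩ | ⟨h1, h2⟩
      · exact hH a b hab hba
      -- The path `y → a → b → x` lies in `H`; by `hiff` so does one from `x` to `y`, which replaces
      -- the new edge.
      · exact hH a b hab ((h1.trans (hiff.2 ((h2.trans hs).trans h1))).trans h2)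
      · exact hH a b hab ((h1.trans (hiff.1 ((h2.trans hs).trans h1))).trans h2)

-- If `x` and `y` reach each other, only the edge is admissible and it merges nothing; if exactly
-- one reaches the other, only the arc in that direction is; if neither does, all three are.
open Classical in
theorem sum_setPair_sign [Finite V] {R : Type*} [CommRing R] (hH : H.TotallyAcyclic)
    (h : ¬ H.gr.Adj x y) :
    (∑ t : Option Bool, if (H.setPair hxy (some t)).TotallyAcyclic then
      (-1 : R) ^ (H.setPair hxy (some t)).gr₀.cc else 0) = (-1) ^ H.gr₀.cc := by
  rw [Fintype.sum_option, Fintype.sum_bool, totallyAcyclic_setPair_forward hxy hH h,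
    totallyAcyclic_setPair_backward hxy hH h, totallyAcyclic_setPair_edge hxy hH h,
    gr₀_setPair_arc hxy h, gr₀_setPair_arc hxy h, gr₀_setPair_edge hxy h]
  have hreach := hH.reachable_iff x y
  by_cases h1 : H.Reach x y <;> by_cases h2 : H.Reach y x
  · simp [h1, h2, SimpleGraph.cc_sup_edge_of_reachable hxy (hreach.2 ⟨h1, h2⟩)]
  · simp [h1, h2]
  · simp [h1, h2]
  -- The edge merges two components, so its sign cancels that of one of the two arcs.
  · rw [SimpleGraph.cc_sup_edge_of_not_reachable hxy fun h => h1 (hreach.1 h).1]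
    simp only [h1, h2, not_false_eq_true, if_true]
    ring

end

end MixedGraph

/-! ### The signed count of orientations containing a given subgraph -/

namespace SimpleGraph

variable {V : Type*} [Fintype V]

-- An orientation of the larger graph amounts to its restriction together with the state of the pair
-- `x, y`. Since `F` does not join this pair, the condition on `F` only concerns the restriction.
open Classical in
theorem sum_totallyAcyclicPartialOrientations_sup_edge {R : Type*} [AddCommMonoid R]
    {F G : SimpleGraph V} {x y : V} (hxy : x ≠ y) (hG : ¬ G.Adj x y) (hF : F ≤ G)
    (f : MixedGraph V → R) :
    ∑ H ∈ (G ⊔ edge x y).totallyAcyclicPartialOrientations with F ≤ H.gr₀, f H =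
      ∑ H ∈ G.totallyAcyclicPartialOrientations with F ≤ H.gr₀, ∑ t : Option Bool,
        if (H.setPair hxy (some t)).TotallyAcyclic then f (H.setPair hxy (some t)) else 0 := by
  rw [← Finset.sum_product', ← Finset.sum_filter]
  symm
  refine Finset.sum_bij (fun p _ => p.1.setPair hxy (some p.2)) ?_ ?_ ?_ fun _ _ => rfl
  · rintro ⟨H, t⟩ hp
    simp only [Finset.mem_filter, Finset.mem_product, Finset.mem_univ, and_true,
      mem_totallyAcyclicPartialOrientations] at hp ⊢
    obtain ⟨⟨⟨rfl, -⟩, hFH⟩, ht⟩ := hp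
    refine ⟨⟨H.gr_setPair_some hxy t, ht⟩, ?_⟩
    rcases t with _ | t
    · rw [MixedGraph.gr₀_setPair_edge hxy hG]
      exact hFH.trans le_sup_left
    · rwa [MixedGraph.gr₀_setPair_arc hxy hG]
  · rintro ⟨H, t⟩ hp ⟨H', t'⟩ hp' heq
    simp only [Finset.mem_filter, Finset.mem_product, Finset.mem_univ, and_true,
      mem_totallyAcyclicPartialOrientations] at hp hp' heq
    have hHH' : H = H' := by
      rw [← MixedGraph.setPair_none_of_not_adj (H := H) hxy (hp.1.1.1 ▸ hG),
        ← MixedGraph.setPair_none_of_not_adj (H := H') hxy (hp'.1.1.1 ▸ hG),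
        ← H.setPair_setPair hxy (some t), heq, MixedGraph.setPair_setPair]
    subst hHH'
    rw [Option.some_injective _ (H.setPair_injective hxy heq)]
  · intro H hH
    simp only [Finset.mem_filter, mem_totallyAcyclicPartialOrientations] at hH
    have hadj : H.gr.Adj x y := by simp [hH.1.1, edge_adj, hxy]
    obtain ⟨t, ht⟩ := MixedGraph.exists_setPair_some_eq hxy hadj
    refine ⟨(H.setPair hxy none, t), ?_, by rw [MixedGraph.setPair_setPair, ht]⟩
    simp only [Finset.mem_filter, Finset.mem_product, Finset.mem_univ, and_true,
      mem_totallyAcyclicPartialOrientations, MixedGraph.setPair_setPair, ht]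
    refine ⟨⟨⟨?_, hH.1.2.setPair_none hxy⟩, ?_⟩, hH.1.2⟩
    · rw [MixedGraph.gr_setPair_none, hH.1.1]
      ext a b
      simp only [sdiff_adj, sup_adj, edge_adj]
      have := hG
      have := G.adj_comm a b
      grind
    · intro a b hab
      refine Or.inr ⟨fun heq => hG ?_, hH.2 hab⟩
      have := hF hab
      rwa [← mem_edgeSet, ← heq]

open Classical in
/-- The signed count of the totally acyclic partial orientations of `G` whose edges include those
of a spanning subgraph `F`. -/
theorem sum_sign_totallyAcyclicPartialOrientations {R : Type*} [CommRing R]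
    {F G : SimpleGraph V} (hF : F ≤ G) :
    ∑ H ∈ G.totallyAcyclicPartialOrientations with F ≤ H.gr₀, (-1 : R) ^ H.gr₀.cc =
      (-1) ^ F.cc := by
  induction G using WellFoundedLT.induction with | _ G ih
  rcases hF.eq_or_lt with rfl | hlt
  -- When `F = G` every adjacency must be an edge, leaving only the orientation without arcs.
  · let H₀ : MixedGraph V :=
      { edge := F.Adj
        arc := fun _ _ => False
        edge_symm := fun _ _ h => h.symm
        edge_irrefl := fun _ => F.irrefl
        arc_irrefl := fun _ h => h
        not_arc_of_edge := fun _ _ _ h => h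
        not_arc_swap_of_arc := fun _ _ _ h => h }
    rw [show ({H ∈ F.totallyAcyclicPartialOrientations | F ≤ H.gr₀} : Finset _) = {H₀} from ?_,
      Finset.sum_singleton]
    · rfl
    · ext H
      simp only [Finset.mem_filter, Finset.mem_singleton, mem_totallyAcyclicPartialOrientations]
      constructor
      · rintro ⟨⟨hgr, -⟩, hle⟩
        have hedge : ∀ a b, H.edge a b ↔ F.Adj a b := fun a b =>
          ⟨fun h => hgr ▸ H.gr₀_le_gr h, fun h => hle h⟩
        ext a b
        · exact hedge a b
        · refine iff_of_false (fun h => H.not_arc_of_edge a b ((hedge a b).2 ?_) h) id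
          exact hgr ▸ (Or.inr (Or.inl h) : H.gr.Adj a b)
      · rintro rfl
        refine ⟨⟨?_, ?_⟩, le_rfl⟩
        · ext a b
          simp [MixedGraph.gr, H₀]
        · rintro ⟨n, x, -, -, -, i, hi⟩
          exact hi
  · obtain ⟨x, y, hG, hnF⟩ : ∃ x y, G.Adj x y ∧ ¬ F.Adj x y := by
      by_contra! h
      exact hlt.not_ge fun a b hab => h a b hab
    have hxy := hG.ne
    have hsup : G \ edge x y ⊔ edge x y = G := by
      rw [sdiff_sup_cancel]
      exact (edge_le_iff _).2 (Or.inr hG)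
    have hnadj : ¬ (G \ edge x y).Adj x y := by simp [edge_adj, hxy]
    have hF' : F ≤ G \ edge x y := by
      intro a b hab
      refine ⟨hF hab, ?_⟩
      rw [edge_adj]
      rintro ⟨⟨rfl, rfl⟩ | ⟨rfl, rfl⟩, -⟩
      · exact hnF hab
      · exact hnF hab.symm
    have hlt' : G \ edge x y < G :=
      sdiff_le.lt_of_ne fun h => hnadj (by rwa [h])
    rw [← ih _ hlt' hF']
    conv_lhs => rw [← hsup]
    rw [sum_totallyAcyclicPartialOrientations_sup_edge hxy hnadj hF']
    refine Finset.sum_congr rfl fun H hH => ?_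
    simp only [Finset.mem_filter, mem_totallyAcyclicPartialOrientations] at hH
    exact MixedGraph.sum_setPair_sign hxy hH.1.2 (hH.1.1 ▸ hnadj)

end SimpleGraph

/-! ### From the signed count to the two polynomial identities -/

namespace SimpleGraph

variable {V : Type*} [Fintype V]

theorem fromEdgeSet_le_iff_of_subset {V : Type*} {G G' : SimpleGraph V} {F : Set (Sym2 V)}
    (hF : F ⊆ G.edgeSet) : fromEdgeSet F ≤ G' ↔ F ⊆ G'.edgeSet := by
  rw [fromEdgeSet_le]
  refine ⟨fun h e he => h ⟨he, fun hd => G.not_isDiag_of_mem_edgeSet (hF he) hd⟩,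
    fun h => Set.sdiff_subset.trans h⟩

open Classical in
theorem sum_totallyAcyclicPartialOrientations_comm {R : Type*} [AddCommMonoid R]
    (G : SimpleGraph V) (g : MixedGraph V → Finset (Sym2 V) → R) :
    ∑ H ∈ G.totallyAcyclicPartialOrientations, ∑ F ∈ H.gr₀.edgeFinset.powerset, g H F =
      ∑ F ∈ G.edgeFinset.powerset, ∑ H ∈ G.totallyAcyclicPartialOrientations with
        fromEdgeSet (F : Set (Sym2 V)) ≤ H.gr₀, g H F := by
  refine Finset.sum_comm' fun H F => ?_
  simp only [Finset.mem_powerset, Finset.mem_filter, mem_totallyAcyclicPartialOrientations,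
    ← Finset.coe_subset, coe_edgeFinset]
  constructor
  · rintro ⟨⟨rfl, hH⟩, hF⟩
    exact ⟨⟨⟨rfl, hH⟩, (fromEdgeSet_le_iff_of_subset hF).2 hF⟩,
      hF.trans (edgeSet_mono H.gr₀_le_gr)⟩
  · rintro ⟨⟨hH, hF'⟩, hF⟩
    exact ⟨hH, (fromEdgeSet_le_iff_of_subset hF).1 hF'⟩

theorem graphRank_sub_graphRank {G G' : SimpleGraph V} :
    G'.graphRank - G.graphRank = G.cc - G'.cc := by
  have := G.graphRank_add_cc
  have := G'.graphRank_add_cc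
  omega

open Classical in
theorem subst2_fortuinKasteleyn {K : Type*} [CommRing K] (a b : MvPolynomial (Fin 2) K)
    (G : SimpleGraph V) : subst2 a b (G.fortuinKasteleyn K) =
      ∑ F ∈ G.edgeFinset.powerset, a ^ (fromEdgeSet (F : Set (Sym2 V))).cc * b ^ F.card := by
  simp [subst2, fortuinKasteleyn]

open Classical in
theorem tuttePolynomial_eq {K : Type*} [CommRing K] (G : SimpleGraph V) :
    G.tuttePolynomial K = ∑ F ∈ G.edgeFinset.powerset,
      (MvPolynomial.X 0 - 1) ^ ((fromEdgeSet (F : Set (Sym2 V))).cc - G.cc) *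
        (MvPolynomial.X 1 - 1) ^ (fromEdgeSet (F : Set (Sym2 V))).nullity := by
  simp [tuttePolynomial, subst2, rankGenerating, graphRank_sub_graphRank]

open Classical in
theorem subst2_tuttePolynomial {K : Type*} [CommRing K] (a b : MvPolynomial (Fin 2) K)
    (G : SimpleGraph V) : subst2 a b (G.tuttePolynomial K) =
      ∑ F ∈ G.edgeFinset.powerset, (a - 1) ^ ((fromEdgeSet (F : Set (Sym2 V))).cc - G.cc) *
        (b - 1) ^ (fromEdgeSet (F : Set (Sym2 V))).nullity := by
  simp [tuttePolynomial_eq, subst2]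

open Classical in
theorem subst2_neg_fortuinKasteleyn {K : Type*} [CommRing K] (G : SimpleGraph V) :
    subst2 (-MvPolynomial.X 0) (MvPolynomial.X 1) (G.fortuinKasteleyn K) =
      ∑ H ∈ G.totallyAcyclicPartialOrientations,
        (-1) ^ H.gr₀.cc * H.gr₀.fortuinKasteleyn K := by
  simp only [fortuinKasteleyn, Finset.mul_sum]
  rw [sum_totallyAcyclicPartialOrientations_comm, ← fortuinKasteleyn, subst2_fortuinKasteleyn]
  refine Finset.sum_congr rfl fun F hF => ?_
  rw [Finset.mem_powerset, ← Finset.coe_subset, coe_edgeFinset] at hF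
  rw [← Finset.sum_mul, sum_sign_totallyAcyclicPartialOrientations
    ((fromEdgeSet_le_iff_of_subset hF).2 hF), ← mul_assoc, ← mul_pow, neg_one_mul]

/-- Splitting `(-a) ^ (l - n)` at an intermediate exponent, with signs collected. -/
theorem neg_pow_sub_mul_pow_sub {R : Type*} [CommRing R] (a : R) {l m n : ℕ} (hnm : n ≤ m)
    (hml : m ≤ l) :
    (-a) ^ (m - n) * a ^ (l - m) = (-1) ^ m * ((-1) ^ n * a ^ (l - n)) := by
  obtain ⟨i, rfl⟩ := Nat.exists_eq_add_of_le hnm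
  obtain ⟨j, rfl⟩ := Nat.exists_eq_add_of_le hml
  rw [Nat.add_sub_cancel_left, Nat.add_sub_cancel_left, add_assoc n i j,
    Nat.add_sub_cancel_left, neg_pow, pow_add (-1) n i, pow_add a]
  have : (-1 : R) ^ n * (-1) ^ n = 1 := by rw [← mul_pow]; simp
  linear_combination (-(-1) ^ i * a ^ i * a ^ j) * this

open Classical in
theorem subst2_two_sub_tuttePolynomial {K : Type*} [CommRing K] (G : SimpleGraph V) :
    subst2 (2 - MvPolynomial.X 0) (MvPolynomial.X 1) (G.tuttePolynomial K) =
      ∑ H ∈ G.totallyAcyclicPartialOrientations,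
        (1 - MvPolynomial.X 0) ^ (H.gr₀.cc - G.cc) * H.gr₀.tuttePolynomial K := by
  rw [subst2_tuttePolynomial]
  simp only [tuttePolynomial_eq, Finset.mul_sum]
  rw [sum_totallyAcyclicPartialOrientations_comm]
  refine Finset.sum_congr rfl fun F hF => ?_
  rw [Finset.mem_powerset, ← Finset.coe_subset, coe_edgeFinset] at hF
  have hFG := (fromEdgeSet_le_iff_of_subset hF).2 hF
  have hsign := sum_sign_totallyAcyclicPartialOrientations (R := MvPolynomial (Fin 2) K) hFG
  have hcc := cc_anti hFG
  generalize fromEdgeSet (F : Set (Sym2 V)) = J at *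
  -- The exponents telescope because `cc G ≤ cc (gr₀ H) ≤ cc J`; only the sign still depends on `H`.
  have hterm : ∀ H ∈ G.totallyAcyclicPartialOrientations.filter (J ≤ ·.gr₀),
      (1 - MvPolynomial.X 0 : MvPolynomial (Fin 2) K) ^ (H.gr₀.cc - G.cc) *
        ((MvPolynomial.X 0 - 1) ^ (J.cc - H.gr₀.cc) * (MvPolynomial.X 1 - 1) ^ J.nullity) =
      (-1) ^ H.gr₀.cc * ((-1) ^ G.cc * (MvPolynomial.X 0 - 1) ^ (J.cc - G.cc)) *
        (MvPolynomial.X 1 - 1) ^ J.nullity := by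
    intro H hH
    rw [Finset.mem_filter] at hH
    rw [← mul_assoc, ← neg_pow_sub_mul_pow_sub _ (G.cc_le_cc_gr₀ H hH.1) (cc_anti hH.2), neg_sub]
  -- The sign `(-1) ^ cc J` is absorbed by the same splitting with `m = l`, which leaves `-(X - 1) =
  -- (2 - X) - 1` as base.
  rw [Finset.sum_congr rfl hterm, ← Finset.sum_mul, ← Finset.sum_mul, hsign,
    ← neg_pow_sub_mul_pow_sub _ hcc le_rfl, Nat.sub_self, pow_zero, mul_one]
  congr 2
  ring

end SimpleGraph

theorem mainTheorem3 {K : Type*} [Field K] [CharZero K] {V : Type*} [Fintype V]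
    (G : SimpleGraph V) :
    subst2 (-MvPolynomial.X 0) (MvPolynomial.X 1) (G.fortuinKasteleyn K) =
        ∑ H ∈ G.totallyAcyclicPartialOrientations,
          (-1) ^ H.gr₀.cc * H.gr₀.fortuinKasteleyn K ∧
      subst2 (2 - MvPolynomial.X 0) (MvPolynomial.X 1) (G.tuttePolynomial K) =
        ∑ H ∈ G.totallyAcyclicPartialOrientations,
          (1 - MvPolynomial.X 0) ^ (H.gr₀.cc - G.cc) * H.gr₀.tuttePolynomial K :=
  ⟨G.subst2_neg_fortuinKasteleyn, G.subst2_two_sub_tuttePolynomial⟩
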